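/- A $k$-ranking of a finite simple graph $G$ is a labeling $f : V(G) \to \{1, \dots, k\}$ such that every path joining two distinct vertices with the same label passes through a vertex with a strictly larger label. The rank number of $G$ is the smallest $k$ for which $G$ has a $k$-ranking. For $m, n \ge 1$ let $G_{m,n}$ be the $m \times n$ grid graph, i.e. the Cartesian product of a path on $m$ vertices and a path on $n$ vertices, and let $r(m,n)$ be its rank number. Then for every integer $m \ge 1$, $$ r(m,m) \;\ge\; \frac{5}{3}\, m - \frac{25}{9}. $$ -/

import Mathlib

/-- A `k`-ranking of a graph: a labeling of the vertices by `1, …, k` such that every path joining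
two distinct vertices with the same label passes through a vertex with a larger label. -/
def IsRanking {V : Type*} (G : SimpleGraph V) (k : ℕ) (f : V → ℕ) : Prop :=
  (∀ v, 1 ≤ f v ∧ f v ≤ k) ∧
    ∀ u v, u ≠ v → f u = f v → ∀ p : G.Walk u v, p.IsPath → ∃ w ∈ p.support, f u < f w

/-- The rank number of a graph: the smallest `k` for which a `k`-ranking exists. -/
noncomputable def rankNumber {V : Type*} (G : SimpleGraph V) : ℕ :=
  sInf {k | ∃ f : V → ℕ, IsRanking G k f}

/-- A finite graph has a ranking (label all vertices differently), so the infimum defining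
`rankNumber` is a minimum over a nonempty set. -/
theorem isLeast_rankNumber {V : Type*} [Finite V] (G : SimpleGraph V) :
    IsLeast {k | ∃ f : V → ℕ, IsRanking G k f} (rankNumber G) := by
  have hne : {k | ∃ f : V → ℕ, IsRanking G k f}.Nonempty := by
    refine ⟨Nat.card V, fun v => (Finite.equivFin V v : ℕ) + 1, fun v => ⟨Nat.le_add_left 1 _, ?_⟩, ?_⟩
    · exact (Finite.equivFin V v).isLt
    · intro u v huv h
      exact absurd ((Finite.equivFin V).injective (Fin.ext (by simpa using h))) huv
  exact ⟨Nat.sInf_mem hne, fun k hk => Nat.sInf_le hk⟩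

/-- The `m × n` grid graph, the Cartesian product of the paths on `m` and on `n` vertices. -/
def gridGraph (m n : ℕ) : SimpleGraph (Fin m × Fin n) :=
  (SimpleGraph.pathGraph m).boxProd (SimpleGraph.pathGraph n)

/-!
In a connected graph the largest label of a ranking is attained only once, so it can be traded for
the deletion of its vertex. Trading labels until the set `H` of deleted vertices disconnects the
rest, it suffices to bound the number of deleted vertices plus remaining labels. Only the vertices
still joined to the border of the region keep labels: this makes the data restrict to smaller
rectangles, so that such bounds can be proved by induction over rectangles.

If `H` meets the sides of a rectangle too often, the bound for a smaller rectangle already suffices.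
Otherwise `H` separates the first column from the last, and hence contains a path of king moves from
the first row to the last. A window at a vertical side which misses this path contributes its own
bound on top of the length of the path, so a short path must visit many windows, which makes it
long. For `a` columns and `b` rows this gives the bound `min a (2 * b)`. In a square of side `m` it
follows that a short path visits every window of `q` columns and `2 * q` rows at either vertical
side. Visits to different sides are far apart in time, so the path has to turn back, and the best
choice of `q` leads to the bound `(5 * m - 2) / 3`.
-/

open SimpleGraph

section TopLabel

variable {V V' : Type*} {G : SimpleGraph V} {G' : SimpleGraph V'} {k : ℕ}

theorem IsRanking.comp_hom {f : V → ℕ} (hf : IsRanking G k f) (φ : G' →g G)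
    (hφ : Function.Injective φ) : IsRanking G' k (f ∘ φ) := by
  refine ⟨fun v => hf.1 (φ v), fun u v huv h p hp => ?_⟩
  obtain ⟨w, hw, hlt⟩ := hf.2 (φ u) (φ v) (hφ.ne huv) h (p.map φ) (hp.map hφ)
  rw [Walk.support_map, List.mem_map] at hw
  obtain ⟨w, hw, rfl⟩ := hw
  exact ⟨w, hw, hlt⟩

namespace GridRank

/-- A graph is `k`-rankable if it has a `k`-ranking, i.e. if its rank number is at most `k`. -/
def Rankable (G : SimpleGraph V) (k : ℕ) : Prop := ∃ f, IsRanking G k f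

theorem Rankable.of_injective_hom (h : Rankable G k) (φ : G' →g G)
    (hφ : Function.Injective φ) : Rankable G' k :=
  h.imp' (· ∘ φ) fun _ hf => hf.comp_hom φ hφ

theorem Rankable.mono {A B : Set V} (hAB : A ⊆ B) (h : Rankable (G.induce B) k) :
    Rankable (G.induce A) k :=
  h.of_injective_hom (G.induceHomOfLE hAB).toHom (G.induceHomOfLE hAB).injective

/-- A path between two vertices carrying the largest label would pass through a larger one. -/
theorem Rankable.exists_sdiff_singleton {A : Set V} (h : Rankable (G.induce A) k)
    (hA : (G.induce A).Connected) :
    ∃ k', k = k' + 1 ∧ ∃ v ∈ A, Rankable (G.induce (A \ {v})) k' := by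
  obtain ⟨f, hf⟩ := h
  have := hA.nonempty
  have hfin : (Set.range f).Finite :=
    (Set.finite_Iic k).subset (Set.range_subset_iff.2 fun v => (hf.1 v).2)
  obtain ⟨_, ⟨v, rfl⟩, hmax⟩ := Set.exists_max_image _ id hfin (Set.range_nonempty f)
  have hlt : ∀ w ≠ v, f w < f v := by
    refine fun w hw => (hmax _ ⟨w, rfl⟩).lt_of_ne fun he => ?_
    obtain ⟨p, hp⟩ := hA.exists_isPath w v
    obtain ⟨z, -, hz⟩ := hf.2 w v hw he p hp
    exact (hmax _ ⟨z, rfl⟩).not_gt (he ▸ hz)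
  obtain ⟨k', rfl⟩ : ∃ k', k = k' + 1 := ⟨k - 1, by have := hf.1 v; omega⟩
  let ι := G.induceHomOfLE (Set.sdiff_subset : A \ {v.1} ⊆ A)
  refine ⟨k', rfl, v, v.2, f ∘ ι, fun w => ⟨(hf.1 _).1, ?_⟩, (hf.comp_hom ι.toHom ι.injective).2⟩
  have hw : ι w ≠ v := fun he => w.2.2 (congrArg Subtype.val he)
  exact Nat.lt_succ_iff.1 ((hlt _ hw).trans_le (hf.1 v).2)

end GridRank

end TopLabel

namespace GridRank

section Outer

variable {V V' : Type*} {G : SimpleGraph V} {G' : SimpleGraph V'}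

/-- `ReachableIn G A u v` means that some walk of `G` from `u` to `v` stays in `A`; unlike
reachability in `G.induce A` it is a relation on the vertices of `G`. -/
def ReachableIn (G : SimpleGraph V) (A : Set V) (u v : V) : Prop :=
  ∃ p : G.Walk u v, ∀ w ∈ p.support, w ∈ A

namespace ReachableIn

variable {A B : Set V} {u v w : V}

theorem refl (hu : u ∈ A) : ReachableIn G A u u := ⟨.nil, by simpa using hu⟩

theorem left_mem (h : ReachableIn G A u v) : u ∈ A := h.elim fun p hp => hp u p.start_mem_support

theorem right_mem (h : ReachableIn G A u v) : v ∈ A := h.elim fun p hp => hp v p.end_mem_support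

theorem symm (h : ReachableIn G A u v) : ReachableIn G A v u :=
  h.imp' Walk.reverse fun p hp => by simpa using hp

theorem trans (h : ReachableIn G A u v) (h' : ReachableIn G A v w) : ReachableIn G A u w := by
  obtain ⟨p, hp⟩ := h
  obtain ⟨q, hq⟩ := h'
  exact ⟨p.append q, fun z hz => ((Walk.mem_support_append_iff _ _).1 hz).elim (hp z) (hq z)⟩

theorem mono (hAB : A ⊆ B) (h : ReachableIn G A u v) : ReachableIn G B u v :=
  h.imp fun _ hp w hw => hAB (hp w hw)

theorem of_adj (h : G.Adj u v) (hu : u ∈ A) (hv : v ∈ A) : ReachableIn G A u v :=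
  ⟨h.toWalk, by simp [hu, hv]⟩

theorem map {A : Set V} {u v : V'} (φ : G' →g G) (h : ReachableIn G' (φ ⁻¹' A) u v) :
    ReachableIn G A (φ u) (φ v) := by
  obtain ⟨p, hp⟩ := h
  refine ⟨p.map φ, fun w hw => ?_⟩
  rw [Walk.support_map, List.mem_map] at hw
  obtain ⟨w, hw, rfl⟩ := hw
  exact hp w hw

theorem induce (h : ReachableIn G A u v) :
    (G.induce A).Reachable ⟨u, h.left_mem⟩ ⟨v, h.right_mem⟩ :=
  h.elim fun p hp => ⟨p.induce A hp⟩

end ReachableIn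

/-- The vertices of `R` outside `H` that are joined to the border of `R` by a walk avoiding `H`. -/
def outer (G : SimpleGraph V) (R H : Set V) : Set V :=
  {z | ∃ w n, w ∈ R ∧ G.Adj w n ∧ n ∉ R ∧ ReachableIn G (R \ H) z w}

/-- The vertices of `R` outside `H` that `H` separates from the border of `R`. -/
def pocket (G : SimpleGraph V) (R H : Set V) : Set V := (R \ H) \ outer G R H

variable {R W H : Set V} {z n : V}

theorem outer_subset : outer G R H ⊆ R \ H := fun _ ⟨_, _, _, _, _, h⟩ => h.left_mem

theorem mem_outer_of_adj (hz : z ∈ R \ H) (h : G.Adj z n) (hn : n ∉ R) : z ∈ outer G R H :=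
  ⟨z, n, hz.1, h, hn, .refl hz⟩

theorem mem_outer_of_reachableIn {z' : V} (h : ReachableIn G (R \ H) z z')
    (hz' : z' ∈ outer G R H) : z ∈ outer G R H := by
  obtain ⟨w, n, hw, hwn, hn, hr⟩ := hz'
  exact ⟨w, n, hw, hwn, hn, h.trans hr⟩

theorem outer_insert_subset (v : V) : outer G R (insert v H) ⊆ outer G R H \ {v} := by
  have hsub : R \ insert v H ⊆ R \ H := Set.sdiff_subset_sdiff_right (Set.subset_insert v H)
  rintro z ⟨w, n, hw, hwn, hn, hr⟩
  exact ⟨⟨w, n, hw, hwn, hn, hr.mono hsub⟩, fun hz => hr.left_mem.2 (.inl hz)⟩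

theorem outer_inter_subset (hW : W ⊆ R)
    (hp : ∀ z ∈ W, ∀ n, G.Adj z n → n ∉ W → z ∉ pocket G R H) :
    outer G W (H ∩ W) ⊆ outer G R H := by
  have hsub : W \ (H ∩ W) ⊆ R \ H := fun z hz => ⟨hW hz.1, fun h => hz.2 ⟨h, hz.1⟩⟩
  rintro z ⟨w, n, hw, hwn, hn, hr⟩
  refine mem_outer_of_reachableIn (hr.mono hsub) ?_
  by_contra hw'
  exact hp w hw n hwn hn ⟨hsub hr.right_mem, hw'⟩

theorem mapsTo_outer (φ : G' →g G) :
    Set.MapsTo φ (outer G' (φ ⁻¹' R) (φ ⁻¹' H)) (outer G R H) :=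
  fun _ ⟨w, n, hw, hwn, hn, hr⟩ => ⟨φ w, φ n, hw, φ.map_adj hwn, hn,
    hr.map (A := R \ H) φ⟩

theorem connected_outer_of_preimage (σ : G' ≃g G)
    (h : (G'.induce (outer G' (σ ⁻¹' R) (σ ⁻¹' H))).Connected) :
    (G.induce (outer G R H)).Connected := by
  refine h.map (induceHom σ.toHom (mapsTo_outer σ.toHom)) fun ⟨z, hz⟩ => ⟨⟨σ.symm z, ?_⟩, ?_⟩
  · refine mapsTo_outer σ.symm.toHom (R := σ ⁻¹' R) (H := σ ⁻¹' H) ?_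
    simpa [Set.preimage_preimage] using hz
  · exact Subtype.ext (σ.apply_symm_apply z)

theorem connected_outer {c : V} (hc : c ∈ outer G R H)
    (h : ∀ w ∈ R \ H, ∀ n, G.Adj w n → n ∉ R → ReachableIn G (R \ H) w c) :
    (G.induce (outer G R H)).Connected := by
  classical
  rw [connected_iff_exists_forall_reachable]
  refine ⟨⟨c, hc⟩, fun ⟨z, w, n, hw, hwn, hn, hr⟩ => ?_⟩
  obtain ⟨p, hp⟩ := hr.trans (h w hr.right_mem n hwn hn)
  have hp' : ∀ v ∈ p.support, v ∈ outer G R H := fun v hv =>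
    mem_outer_of_reachableIn ⟨p.dropUntil v hv, fun w hw =>
      hp w (Walk.support_dropUntil_subset_support _ hv hw)⟩ hc
  exact (ReachableIn.induce ⟨p, hp'⟩).symm

theorem mem_or_mem_pocket_of_adj (hz : z ∈ pocket G R H) (h : G.Adj z n) :
    n ∈ H ∨ n ∈ pocket G R H := by
  by_cases hn : n ∈ R
  · refine or_iff_not_imp_left.2 fun hnH => ⟨⟨hn, hnH⟩, fun ho => hz.2 ?_⟩
    exact mem_outer_of_reachableIn (.of_adj h hz.1 ⟨hn, hnH⟩) ho
  · exact absurd (mem_outer_of_adj hz.1 h hn) hz.2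

theorem exists_mem_of_mem_pocket {s : ℕ → V} (h0 : s 0 ∈ pocket G R H)
    (hs : ∀ i, G.Adj (s i) (s (i + 1))) (hR : ∃ i, s i ∉ R) :
    ∃ n, 0 < n ∧ s n ∈ H ∧ ∀ i < n, s i ∈ pocket G R H := by
  classical
  have hex : ∃ i, s i ∉ pocket G R H := hR.imp fun i hi hp => hi hp.1.1
  have hmin : ∀ i < Nat.find hex, s i ∈ pocket G R H := fun i hi => not_not.1 (Nat.find_min hex hi)
  have hpos : Nat.find hex ≠ 0 := fun h => Nat.find_spec hex (h ▸ h0)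
  obtain ⟨j, hj⟩ := Nat.exists_eq_add_one_of_ne_zero hpos
  refine ⟨j + 1, j.succ_pos, ?_, hj ▸ hmin⟩
  exact (mem_or_mem_pocket_of_adj (hmin j (by omega)) (hs j)).resolve_right
    (hj ▸ Nat.find_spec hex)

end Outer

section OuterRanking

variable {V V' : Type*} {G : SimpleGraph V} {G' : SimpleGraph V'} {R W H : Set V} {k c : ℕ}

/-- After deleting the finite set `H` from `R`, the part of `R` joined to its border is
`k`-rankable. The parts cut off from the border need no labels, so that a ranking of a large region
restricts to this data on every window whose border meets no pocket. -/
structure OuterRanking (G : SimpleGraph V) (R H : Set V) (k : ℕ) : Prop where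
  subset : H ⊆ R
  finite : H.Finite
  rankable : Rankable (G.induce (outer G R H)) k

/-- In every `OuterRanking` of `R`, deleted vertices and labels together number at least `c`. -/
def LabelBound (G : SimpleGraph V) (R : Set V) (c : ℕ) : Prop :=
  ∀ H k, OuterRanking G R H k → c ≤ H.ncard + k

theorem OuterRanking.preimage (h : OuterRanking G R H k) (φ : G' →g G)
    (hφ : Function.Injective φ) : OuterRanking G' (φ ⁻¹' R) (φ ⁻¹' H) k where
  subset := Set.preimage_mono h.subset
  finite := h.finite.preimage hφ.injOn
  rankable := h.rankable.of_injective_hom (induceHom φ (mapsTo_outer φ))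
    (induceHom_injective φ _ hφ.injOn)

theorem OuterRanking.restrict (h : OuterRanking G R H k) (hW : W ⊆ R)
    (hp : ∀ z ∈ W, ∀ n, G.Adj z n → n ∉ W → z ∉ pocket G R H) :
    OuterRanking G W (H ∩ W) k where
  subset := Set.inter_subset_right
  finite := h.finite.subset Set.inter_subset_left
  rankable := h.rankable.mono (outer_inter_subset hW hp)

theorem OuterRanking.le_ncard_inter (h : OuterRanking G R H k) (hc : LabelBound G W c)
    (hW : W ⊆ R) (hp : ∀ z ∈ W, ∀ n, G.Adj z n → n ∉ W → z ∉ pocket G R H) :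
    c ≤ (H ∩ W).ncard + k :=
  hc _ _ (h.restrict hW hp)

theorem OuterRanking.exists_insert (h : OuterRanking G R H k)
    (hconn : (G.induce (outer G R H)).Connected) :
    ∃ k', k = k' + 1 ∧ ∃ v ∉ H, OuterRanking G R (insert v H) k' := by
  obtain ⟨k', rfl, v, hv, hr⟩ := h.rankable.exists_sdiff_singleton hconn
  have hvR := outer_subset hv
  exact ⟨k', rfl, v, hvR.2, Set.insert_subset hvR.1 h.subset, h.finite.insert v,
    hr.mono (outer_insert_subset v)⟩

/-- While the outer part is connected, its unique largest label can be traded for the vertex that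
carries it, at no cost. -/
theorem labelBound_of_not_connected
    (h : ∀ H k, OuterRanking G R H k → ¬ (G.induce (outer G R H)).Connected → c ≤ H.ncard + k) :
    LabelBound G R c := by
  intro H k
  induction k generalizing H with
  | zero =>
    intro hH
    refine h H 0 hH fun hconn => ?_
    obtain ⟨k', hk', -⟩ := hH.exists_insert hconn
    omega
  | succ k ih =>
    intro hH
    by_cases hconn : (G.induce (outer G R H)).Connected
    · obtain ⟨k', hk', v, hv, hr⟩ := hH.exists_insert hconn
      obtain rfl : k = k' := by omega
      have := ih _ hr
      rw [Set.ncard_insert_of_notMem hv hH.finite] at this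
      omega
    · exact h H _ hH hconn

end OuterRanking

section Lattice

/-- The square lattice on `ℤ × ℤ`. -/
noncomputable def lattice : SimpleGraph (ℤ × ℤ) := hasse ℤ □ hasse ℤ

theorem lattice_adj {p q : ℤ × ℤ} :
    lattice.Adj p q ↔ p.1 = q.1 ∧ (q.2 = p.2 + 1 ∨ p.2 = q.2 + 1) ∨
      p.2 = q.2 ∧ (q.1 = p.1 + 1 ∨ p.1 = q.1 + 1) := by
  simp only [lattice, boxProd_adj, hasse_adj, Order.covBy_iff_add_one_eq]
  omega

/-- The reflection `(i, j) ↦ (s - i, j)` of the lattice. -/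
def reflectFst (s : ℤ) : lattice ≃g lattice where
  toEquiv := (Equiv.subLeft s).prodCongr (Equiv.refl ℤ)
  map_rel_iff' := by
    simp only [Equiv.prodCongr_apply, Equiv.coe_refl, lattice_adj, Prod.map_fst,
      Equiv.subLeft_apply, sub_right_inj, Prod.map_snd, id_eq, Prod.forall]
    omega

/-- The reflection `(i, j) ↦ (i, s - j)` of the lattice. -/
def reflectSnd (s : ℤ) : lattice ≃g lattice where
  toEquiv := (Equiv.refl ℤ).prodCongr (Equiv.subLeft s)
  map_rel_iff' := by
    simp only [Equiv.prodCongr_apply, Equiv.coe_refl, lattice_adj, Prod.map_fst, id_eq,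
      Prod.map_snd, Equiv.subLeft_apply, sub_right_inj, Prod.forall]
    omega

/-- The reflection `(i, j) ↦ (j, i)` of the lattice. -/
noncomputable def transpose : lattice ≃g lattice := boxProdComm _ _

@[simp] theorem reflectFst_apply (s : ℤ) (z : ℤ × ℤ) : reflectFst s z = (s - z.1, z.2) := rfl

@[simp] theorem reflectSnd_apply (s : ℤ) (z : ℤ × ℤ) : reflectSnd s z = (z.1, s - z.2) := rfl

@[simp] theorem transpose_apply (z : ℤ × ℤ) : transpose z = (z.2, z.1) := rfl

theorem reachableIn_row {A : Set (ℤ × ℤ)} {s t j : ℤ} (h : ∀ i ∈ Set.uIcc s t, (i, j) ∈ A) :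
    ReachableIn lattice A (s, j) (t, j) := by
  wlog hst : s ≤ t generalizing s t
  · exact (this (by rwa [Set.uIcc_comm]) (by omega)).symm
  rw [Set.uIcc_of_le hst] at h
  induction t, hst using Int.leInduction with
  | base => exact .refl (h s ⟨le_rfl, le_rfl⟩)
  | succ t hst ih =>
    have hadj : lattice.Adj (t, j) (t + 1, j) := by simp [lattice_adj]
    exact (ih fun i hi => h i ⟨hi.1, hi.2.trans (by omega)⟩).trans
      (.of_adj hadj (h t ⟨hst, by omega⟩) (h (t + 1) ⟨by omega, le_rfl⟩))

theorem reachableIn_column {A : Set (ℤ × ℤ)} {i s t : ℤ} (h : ∀ j ∈ Set.uIcc s t, (i, j) ∈ A) :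
    ReachableIn lattice A (i, s) (i, t) :=
  (reachableIn_row (A := transpose ⁻¹' A) (j := i) (s := s) (t := t) h).map transpose.toHom

/-- The rectangle with `a` columns, `b` rows and smallest corner `(x, y)`. -/
def rect (x y : ℤ) (a b : ℕ) : Set (ℤ × ℤ) := Set.Ico x (x + a) ×ˢ Set.Ico y (y + b)

variable {x y x' y' : ℤ} {a b a' b' k c : ℕ} {H : Set (ℤ × ℤ)} {z n : ℤ × ℤ}

theorem mem_rect : z ∈ rect x y a b ↔ (x ≤ z.1 ∧ z.1 < x + a) ∧ y ≤ z.2 ∧ z.2 < y + b := Iff.rfl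

theorem rect_subset_rect (hx : x ≤ x') (hxa : x' + a' ≤ x + a) (hy : y ≤ y')
    (hyb : y' + b' ≤ y + b) : rect x' y' a' b' ⊆ rect x y a b := by
  intro z
  simp only [mem_rect]
  omega

theorem preimage_reflectFst_rect :
    reflectFst (2 * x + a - 1) ⁻¹' rect x y a b = rect x y a b := by
  ext z
  simp only [Set.mem_preimage, mem_rect, reflectFst_apply]
  omega

theorem preimage_reflectSnd_rect :
    reflectSnd (2 * y + b - 1) ⁻¹' rect x y a b = rect x y a b := by
  ext z
  simp only [Set.mem_preimage, mem_rect, reflectSnd_apply]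
  omega

theorem preimage_transpose_rect : transpose ⁻¹' rect x y a b = rect y x b a := by
  ext z
  simp only [Set.mem_preimage, mem_rect, transpose_apply, and_comm]

theorem ncard_preimage_iso (σ : lattice ≃g lattice) : (σ ⁻¹' H).ncard = H.ncard :=
  Set.ncard_preimage_of_injective_subset_range σ.injective (by simp [σ.surjective.range_eq])

theorem OuterRanking.reflectFst (h : OuterRanking lattice (rect x y a b) H k) :
    OuterRanking lattice (rect x y a b) (reflectFst (2 * x + a - 1) ⁻¹' H) k := by
  simpa [preimage_reflectFst_rect] using
    h.preimage (GridRank.reflectFst (2 * x + a - 1)).toHom (RelIso.injective _)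

theorem OuterRanking.reflectSnd (h : OuterRanking lattice (rect x y a b) H k) :
    OuterRanking lattice (rect x y a b) (reflectSnd (2 * y + b - 1) ⁻¹' H) k := by
  simpa [preimage_reflectSnd_rect] using
    h.preimage (GridRank.reflectSnd (2 * y + b - 1)).toHom (RelIso.injective _)

theorem OuterRanking.transpose (h : OuterRanking lattice (rect x y a b) H k) :
    OuterRanking lattice (rect y x b a) (transpose ⁻¹' H) k := by
  simpa [preimage_transpose_rect] using
    h.preimage GridRank.transpose.toHom (RelIso.injective _)

theorem LabelBound.transpose (h : LabelBound lattice (rect x y a b) c) :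
    LabelBound lattice (rect y x b a) c :=
  fun _ _ hH => ncard_preimage_iso GridRank.transpose ▸ h _ _ hH.transpose

end Lattice

section RectPockets

variable {x y x' y' : ℤ} {a b a' b' k c : ℕ} {H : Set (ℤ × ℤ)} {z n : ℤ × ℤ}

theorem mem_side_of_adj (hz : z ∈ rect x y a b) (h : lattice.Adj z n) (hn : n ∉ rect x y a b) :
    z.1 = x ∨ z.1 = x + a - 1 ∨ z.2 = y ∨ z.2 = y + b - 1 := by
  rw [mem_rect] at hz hn
  rw [lattice_adj] at h
  omega

theorem exists_adj_notMem_of_mem_side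
    (hz : z.1 = x ∨ z.1 = x + a - 1 ∨ z.2 = y ∨ z.2 = y + b - 1) :
    ∃ n ∉ rect x y a b, lattice.Adj z n := by
  simp only [mem_rect, lattice_adj]
  rcases hz with hz | hz | hz | hz
  · exact ⟨(z.1 - 1, z.2), by dsimp only; omega, by simp⟩
  · exact ⟨(z.1 + 1, z.2), by dsimp only; omega, by simp⟩
  · exact ⟨(z.1, z.2 - 1), by dsimp only; omega, by simp⟩
  · exact ⟨(z.1, z.2 + 1), by dsimp only; omega, by simp⟩

theorem mem_outer_of_mem_side (hz : z ∈ rect x y a b \ H)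
    (hside : z.1 = x ∨ z.1 = x + a - 1 ∨ z.2 = y ∨ z.2 = y + b - 1) :
    z ∈ outer lattice (rect x y a b) H :=
  have ⟨_, hn, hadj⟩ := exists_adj_notMem_of_mem_side hside
  mem_outer_of_adj hz hadj hn

theorem interior_of_mem_pocket (h : z ∈ pocket lattice (rect x y a b) H) :
    (x < z.1 ∧ z.1 < x + a - 1) ∧ y < z.2 ∧ z.2 < y + b - 1 := by
  have hz := mem_rect.1 h.1.1
  have := mt (mem_outer_of_mem_side h.1) h.2
  omega

theorem OuterRanking.le_ncard_inter_rect (h : OuterRanking lattice (rect x y a b) H k)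
    (hc : LabelBound lattice (rect x' y' a' b') c) (hsub : rect x' y' a' b' ⊆ rect x y a b)
    (hp : ∀ z ∈ pocket lattice (rect x y a b) H, z ∈ rect x' y' a' b' →
      z.1 ≠ x' ∧ z.1 ≠ x' + a' - 1 ∧ z.2 ≠ y' ∧ z.2 ≠ y' + b' - 1) :
    c ≤ (H ∩ rect x' y' a' b').ncard + k := by
  refine h.le_ncard_inter hc hsub fun z hz n hn hnW hzp => ?_
  have := mem_side_of_adj hz hn hnW
  have := hp z hzp hz
  omega

theorem exists_right_of_mem_pocket (h : z ∈ pocket lattice (rect x y a b) H) :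
    ∃ t > z.1, (t, z.2) ∈ H ∧
      ∀ i, z.1 ≤ i → i < t → (i, z.2) ∈ pocket lattice (rect x y a b) H := by
  obtain ⟨n, hn, hnH, hp⟩ := exists_mem_of_mem_pocket (s := fun i => (z.1 + i, z.2)) (by simpa)
    (fun i => by rw [lattice_adj]; push_cast; omega)
    ⟨a, fun hR => by have := mem_rect.1 h.1.1; simp only [mem_rect] at hR; omega⟩
  refine ⟨z.1 + n, by omega, hnH, fun i hi hin => ?_⟩
  simpa [hi] using hp (i - z.1).toNat (by omega)

theorem exists_left_of_mem_pocket (h : z ∈ pocket lattice (rect x y a b) H) :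
    ∃ t < z.1, (t, z.2) ∈ H ∧
      ∀ i, t < i → i ≤ z.1 → (i, z.2) ∈ pocket lattice (rect x y a b) H := by
  obtain ⟨n, hn, hnH, hp⟩ := exists_mem_of_mem_pocket (s := fun i => (z.1 - i, z.2)) (by simpa)
    (fun i => by rw [lattice_adj]; push_cast; omega)
    ⟨a, fun hR => by have := mem_rect.1 h.1.1; simp only [mem_rect] at hR; omega⟩
  refine ⟨z.1 - n, by omega, hnH, fun i hi hin => ?_⟩
  simpa [hin] using hp (z.1 - i).toNat (by omega)

theorem exists_above_of_mem_pocket (h : z ∈ pocket lattice (rect x y a b) H) :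
    ∃ t > z.2, (z.1, t) ∈ H ∧
      ∀ j, z.2 ≤ j → j < t → (z.1, j) ∈ pocket lattice (rect x y a b) H := by
  obtain ⟨n, hn, hnH, hp⟩ := exists_mem_of_mem_pocket (s := fun i => (z.1, z.2 + i)) (by simpa)
    (fun i => by rw [lattice_adj]; push_cast; omega)
    ⟨b, fun hR => by have := mem_rect.1 h.1.1; simp only [mem_rect] at hR; omega⟩
  refine ⟨z.2 + n, by omega, hnH, fun j hj hjn => ?_⟩
  simpa [hj] using hp (j - z.2).toNat (by omega)

theorem exists_below_of_mem_pocket (h : z ∈ pocket lattice (rect x y a b) H) :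
    ∃ t < z.2, (z.1, t) ∈ H ∧
      ∀ j, t < j → j ≤ z.2 → (z.1, j) ∈ pocket lattice (rect x y a b) H := by
  obtain ⟨n, hn, hnH, hp⟩ := exists_mem_of_mem_pocket (s := fun i => (z.1, z.2 - i)) (by simpa)
    (fun i => by rw [lattice_adj]; push_cast; omega)
    ⟨b, fun hR => by have := mem_rect.1 h.1.1; simp only [mem_rect] at hR; omega⟩
  refine ⟨z.2 - n, by omega, hnH, fun j hj hjn => ?_⟩
  simpa [hjn] using hp (z.2 - j).toNat (by omega)

end RectPockets

section Counting

variable {α : Type*} {H W W' X : Set α} {z z' : α}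

theorem ncard_inter_add_ncard_le (hH : H.Finite) (hW : W' ⊆ W) (hX : X ⊆ H ∩ (W \ W')) :
    (H ∩ W').ncard + X.ncard ≤ (H ∩ W).ncard := by
  rw [← Set.ncard_union_eq (Set.disjoint_left.2 fun z hz hzX => (hX hzX).2.2 hz.2)
    (hH.inter_of_left W') (hH.subset fun z hz => (hX hz).1)]
  exact Set.ncard_le_ncard (Set.union_subset (Set.inter_subset_inter_right H hW)
    fun z hz => ⟨(hX hz).1, (hX hz).2.1⟩) (hH.inter_of_left W)

theorem ncard_inter_add_one_le (hH : H.Finite) (hW : W' ⊆ W) (hz : z ∈ H) (hzW : z ∈ W)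
    (hzW' : z ∉ W') : (H ∩ W').ncard + 1 ≤ (H ∩ W).ncard := by
  simpa using ncard_inter_add_ncard_le hH hW (Set.singleton_subset_iff.2 ⟨hz, hzW, hzW'⟩)

theorem ncard_inter_add_two_le (hH : H.Finite) (hW : W' ⊆ W) (hne : z ≠ z') (hz : z ∈ H)
    (hzW : z ∈ W) (hzW' : z ∉ W') (hz' : z' ∈ H) (hz'W : z' ∈ W) (hz'W' : z' ∉ W') :
    (H ∩ W').ncard + 2 ≤ (H ∩ W).ncard := by
  rw [← Set.ncard_pair hne]
  exact ncard_inter_add_ncard_le hH hW (Set.pair_subset ⟨hz, hzW, hzW'⟩ ⟨hz', hz'W, hz'W'⟩)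

end Counting

section Peeling

variable {x y y' y'' : ℤ} {a b w P P' m k : ℕ} {H : Set (ℤ × ℤ)} {z z' : ℤ × ℤ}

theorem OuterRanking.ncard_inter_add_one_le_of_mem_pocket
    (h : OuterRanking lattice (rect x y a b) H k) (hz : z ∈ pocket lattice (rect x y a b) H)
    (hzW : z ∈ rect x y' w P) (hsub : rect x y'' w P' ⊆ rect x y' w P)
    (hz' : z.2 < y'' ∨ y'' + P' ≤ z.2) :
    (H ∩ rect x y'' w P').ncard + 1 ≤ (H ∩ rect x y' w P).ncard := by
  obtain ⟨t, ht, htH, -⟩ := exists_left_of_mem_pocket hz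
  have htR := h.subset htH
  simp only [mem_rect] at htR hzW
  refine ncard_inter_add_one_le h.finite hsub htH ?_ ?_ <;> simp only [mem_rect] <;> omega

theorem OuterRanking.ncard_inter_add_two_le_of_mem_pocket
    (h : OuterRanking lattice (rect x y a b) H k) (hz : z ∈ pocket lattice (rect x y a b) H)
    (hzW : z ∈ rect x y' (w + 1) P) (hzx : z.1 = x + w)
    (hrow : ∀ v ∈ pocket lattice (rect x y a b) H, v ∈ rect x y' (w + 1) P →
      v.2 ≠ y' ∧ v.2 ≠ y' + P - 1) :
    (H ∩ rect x y' w P).ncard + 2 ≤ (H ∩ rect x y' (w + 1) P).ncard := by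
  obtain ⟨s, hs, hsH, hsp⟩ := exists_below_of_mem_pocket hz
  obtain ⟨t, ht, htH, htp⟩ := exists_above_of_mem_pocket hz
  simp only [mem_rect] at hzW hrow
  have hs' : y' ≤ s := by
    by_contra hc
    exact (hrow _ (hsp y' (by omega) (by omega)) (by dsimp only; omega)).1 rfl
  have ht' : t < y' + P := by
    by_contra hc
    exact (hrow _ (htp (y' + P - 1) (by omega) (by omega)) (by dsimp only; omega)).2 rfl
  have hsub : rect x y' w P ⊆ rect x y' (w + 1) P :=
    rect_subset_rect le_rfl (by omega) le_rfl le_rfl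
  have hne : (z.1, s) ≠ (z.1, t) := ne_of_apply_ne Prod.snd (hs.trans ht).ne
  refine ncard_inter_add_two_le h.finite hsub hne hsH ?_ ?_ htH ?_ ?_ <;>
  simp only [mem_rect] <;> omega

theorem OuterRanking.le_ncard_inter_left_window (h : OuterRanking lattice (rect x y a b) H k)
    (hD : ∀ w' ≤ w, ∀ P' ≤ P, ∀ y', LabelBound lattice (rect x y' w' P') (min P' (2 * w')))
    (hw : w ≤ a) (hy : y ≤ y') (hP : y' + P ≤ y + b) :
    min P (2 * w) ≤ (H ∩ rect x y' w P).ncard + k := by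
  induction hn : w + P generalizing w P y' with
  | zero => omega
  | succ n ih =>
    rcases P with _ | P
    · simp
    have drop_row {z y''} (hz : z ∈ pocket lattice (rect x y a b) H)
        (hzW : z ∈ rect x y' w (P + 1))
        (hz2 : z.2 = y' ∧ y'' = y' + 1 ∨ z.2 = y' + P ∧ y'' = y') :
        min (P + 1) (2 * w) ≤ (H ∩ rect x y' w (P + 1)).ncard + k := by
      have hdrop := h.ncard_inter_add_one_le_of_mem_pocket (y'' := y'') (P' := P) hz hzW
        (rect_subset_rect le_rfl le_rfl (by omega) (by push_cast; omega)) (by omega)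
      have := ih (P := P) (y' := y'') (fun w' hw' P' hP' => hD w' hw' P' (by omega)) hw (by omega)
        (by push_cast at hP; omega) (by omega)
      omega
    by_cases hrow : ∃ z ∈ pocket lattice (rect x y a b) H, z ∈ rect x y' w (P + 1) ∧
        (z.2 = y' ∨ z.2 = y' + P)
    · obtain ⟨z, hz, hzW, hz2 | hz2⟩ := hrow
      · exact drop_row hz hzW (.inl ⟨hz2, rfl⟩)
      · exact drop_row hz hzW (.inr ⟨hz2, rfl⟩)
    push Not at hrow
    have hrow' : ∀ v ∈ pocket lattice (rect x y a b) H, v ∈ rect x y' w (P + 1) →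
        v.2 ≠ y' ∧ v.2 ≠ y' + (P + 1 : ℕ) - 1 := fun v hv hvW => by
      have := hrow v hv hvW
      push_cast
      omega
    by_cases hcol : ∃ z ∈ pocket lattice (rect x y a b) H, z ∈ rect x y' w (P + 1) ∧
        z.1 = x + w - 1
    · obtain ⟨z, hz, hzW, hz1⟩ := hcol
      obtain ⟨w, rfl⟩ : ∃ w', w = w' + 1 := ⟨w - 1, by rw [mem_rect] at hzW; omega⟩
      have hdrop := h.ncard_inter_add_two_le_of_mem_pocket hz hzW (by push_cast at hz1; omega) hrow'
      have := ih (w := w) (fun w' hw' => hD w' (by omega)) (by omega) hy hP (by omega)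
      omega
    push Not at hcol
    refine h.le_ncard_inter_rect (hD w le_rfl _ le_rfl y')
      (rect_subset_rect le_rfl (by omega) hy hP)
      fun z hz hzW => ⟨?_, hcol z hz hzW, hrow' z hz hzW⟩
    have := interior_of_mem_pocket hz
    omega

theorem OuterRanking.le_ncard_inter_columns (h : OuterRanking lattice (rect x y a b) H k)
    (hD : ∀ a' < a, ∀ x', LabelBound lattice (rect x' y a' b) (min a' (2 * b)))
    (n : ℕ) (hn : n < a) : min n (2 * b) ≤ (H ∩ rect (x + a - n) y n b).ncard + k := by
  induction n with
  | zero => simp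
  | succ n ih =>
    by_cases hcol : ∃ z ∈ pocket lattice (rect x y a b) H, z.1 = x + a - (n + 1 : ℕ)
    · obtain ⟨z, hz, hz1⟩ := hcol
      obtain ⟨t, -, htH, -⟩ := exists_above_of_mem_pocket hz
      have htR := mem_rect.1 (h.subset htH)
      have hsub : rect (x + a - n) y n b ⊆ rect (x + a - (n + 1 : ℕ)) y (n + 1) b :=
        rect_subset_rect (by omega) (by omega) le_rfl le_rfl
      have hdrop := ncard_inter_add_one_le h.finite hsub htH (by simp only [mem_rect]; omega)
        (by simp only [mem_rect]; omega)
      have := ih (by omega)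
      omega
    · push Not at hcol
      refine h.le_ncard_inter_rect (hD (n + 1) hn _)
        (rect_subset_rect (by omega) (by omega) le_rfl le_rfl) fun z hz _ => ?_
      have := interior_of_mem_pocket hz
      have := hcol z hz
      omega

theorem OuterRanking.le_ncard_inter_rows (h : OuterRanking lattice (rect x y a b) H k)
    (hD : ∀ b' < b, ∀ y', LabelBound lattice (rect x y' a b') (min a (2 * b')))
    (n : ℕ) (hn : n < b) : min a (2 * n) ≤ (H ∩ rect x (y + b - n) a n).ncard + k := by
  induction n with
  | zero => simp
  | succ n ih =>
    by_cases hrow : ∃ z ∈ pocket lattice (rect x y a b) H, z.2 = y + b - (n + 1 : ℕ)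
    · obtain ⟨z, hz, hz1⟩ := hrow
      obtain ⟨s, hs, hsH, -⟩ := exists_left_of_mem_pocket hz
      obtain ⟨t, ht, htH, -⟩ := exists_right_of_mem_pocket hz
      have hsR := mem_rect.1 (h.subset hsH)
      have htR := mem_rect.1 (h.subset htH)
      have hsub : rect x (y + b - n) a n ⊆ rect x (y + b - (n + 1 : ℕ)) a (n + 1) :=
        rect_subset_rect le_rfl le_rfl (by omega) (by omega)
      have hne : (s, z.2) ≠ (t, z.2) := ne_of_apply_ne Prod.fst (hs.trans ht).ne
      have hdrop : (H ∩ rect x (y + b - n) a n).ncard + 2 ≤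
          (H ∩ rect x (y + b - (n + 1 : ℕ)) a (n + 1)).ncard := by
        refine ncard_inter_add_two_le h.finite hsub hne hsH ?_ ?_ htH ?_ ?_ <;>
        simp only [mem_rect] <;> omega
      have := ih (by omega)
      omega
    · push Not at hrow
      refine h.le_ncard_inter_rect (hD (n + 1) hn _)
        (rect_subset_rect le_rfl le_rfl (by omega) (by omega)) fun z hz _ => ?_
      have := interior_of_mem_pocket hz
      have := hrow z hz
      omega

/-- A vertical exit of the pocket that misses the arm leaves through its corner, which then lies in
the pocket and has exits along both arms. -/
theorem exists_two_mem_of_pocket_meets_lower_left_arms {p q : ℤ}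
    (hz : z ∈ pocket lattice (rect x y a b) H)
    (hzL : z.1 = p ∧ q ≤ z.2 ∨ z.2 = q ∧ p ≤ z.1) :
    ∃ u ∈ H, ∃ v ∈ H, u ≠ v ∧ (u.1 = p ∧ q ≤ u.2 ∨ u.2 = q ∧ p ≤ u.1) ∧
      (v.1 = p ∧ q ≤ v.2 ∨ v.2 = q ∧ p ≤ v.1) := by
  by_cases hc : (p, q) ∈ pocket lattice (rect x y a b) H
  · obtain ⟨s, hs, hsH, -⟩ := exists_above_of_mem_pocket hc
    obtain ⟨t, ht, htH, -⟩ := exists_right_of_mem_pocket hc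
    exact ⟨_, hsH, _, htH, ne_of_apply_ne Prod.snd hs.ne',
      by dsimp only at *; omega, by dsimp only at *; omega⟩
  rcases hzL with ⟨rfl, hzq⟩ | ⟨rfl, hzp⟩
  · obtain ⟨s, hs, hsH, hsp⟩ := exists_below_of_mem_pocket hz
    obtain ⟨t, ht, htH, -⟩ := exists_above_of_mem_pocket hz
    have hsq : q ≤ s := not_lt.1 fun hlt => hc (hsp q hlt hzq)
    exact ⟨_, hsH, _, htH, ne_of_apply_ne Prod.snd (hs.trans ht).ne,
      .inl ⟨rfl, hsq⟩, .inl ⟨rfl, by dsimp only; omega⟩⟩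
  · obtain ⟨s, hs, hsH, hsp⟩ := exists_left_of_mem_pocket hz
    obtain ⟨t, ht, htH, -⟩ := exists_right_of_mem_pocket hz
    have hsp : p ≤ s := not_lt.1 fun hlt => hc (hsp p hlt hzp)
    exact ⟨_, hsH, _, htH, ne_of_apply_ne Prod.fst (hs.trans ht).ne,
      .inr ⟨rfl, hsp⟩, .inr ⟨rfl, by dsimp only; omega⟩⟩

theorem OuterRanking.le_ncard_inter_corner (h : OuterRanking lattice (rect x y m m) H k)
    (hD : ∀ m' < m, ∀ x' y', LabelBound lattice (rect x' y' m' m') ((5 * m' - 2) / 3))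
    (n : ℕ) (hn : n < m) :
    (5 * n - 2) / 3 ≤ (H ∩ rect (x + m - n) (y + m - n) n n).ncard + k := by
  induction n with
  | zero => simp
  | succ n ih =>
    set p := x + m - (n + 1 : ℕ)
    set q := y + m - (n + 1 : ℕ)
    by_cases harm : ∃ z ∈ pocket lattice (rect x y m m) H,
        z.1 = p ∧ q ≤ z.2 ∨ z.2 = q ∧ p ≤ z.1
    · obtain ⟨z, hz, hzL⟩ := harm
      obtain ⟨u, hu, v, hv, hne, huL, hvL⟩ := exists_two_mem_of_pocket_meets_lower_left_arms hz hzL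
      have huR := mem_rect.1 (h.subset hu)
      have hvR := mem_rect.1 (h.subset hv)
      have hsub : rect (x + m - n) (y + m - n) n n ⊆ rect p q (n + 1) (n + 1) :=
        rect_subset_rect (by omega) (by omega) (by omega) (by omega)
      have hdrop : (H ∩ rect (x + m - n) (y + m - n) n n).ncard + 2 ≤
          (H ∩ rect p q (n + 1) (n + 1)).ncard := by
        refine ncard_inter_add_two_le h.finite hsub hne hu ?_ ?_ hv ?_ ?_ <;>
        simp only [mem_rect] <;> omega
      have := ih (by omega)
      omega
    · push Not at harm
      refine h.le_ncard_inter_rect (hD (n + 1) hn p q)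
        (rect_subset_rect (by omega) (by omega) (by omega) (by omega)) fun z hz hzW => ?_
      have := interior_of_mem_pocket hz
      have := harm z hz
      rw [mem_rect] at hzW
      omega

end Peeling

section ConnectedOuter

variable {x y : ℤ} {a b : ℕ} {H : Set (ℤ × ℤ)} {p w : ℤ × ℤ}

/-- Deleting `H` leaves no walk in the rectangle from its first to its last column. -/
def SeparatesColumns (x y : ℤ) (a b : ℕ) (H : Set (ℤ × ℤ)) : Prop :=
  ∀ j j', ¬ ReachableIn lattice (rect x y a b \ H) (x, j) (x + a - 1, j')

theorem exists_reachableIn_end_of_row (hw : w ∈ rect x y a b \ H)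
    (hrow : ∀ p ∈ H, ∀ q ∈ H, p.2 = w.2 → q.2 = w.2 → p = q) :
    ∃ s, (s = x ∨ s = x + a - 1) ∧ ReachableIn lattice (rect x y a b \ H) w (s, w.2) := by
  have hwR := mem_rect.1 hw.1
  have reach {s : ℤ} (hs : x ≤ s ∧ s < x + a) (hH : ∀ i ∈ Set.uIcc w.1 s, (i, w.2) ∉ H) :
      ReachableIn lattice (rect x y a b \ H) w (s, w.2) := by
    refine reachableIn_row (s := w.1) (j := w.2) fun i hi => ⟨?_, hH i hi⟩
    rw [Set.mem_uIcc] at hi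
    simp only [mem_rect]
    omega
  by_cases hleft : ∃ p ∈ H, p.2 = w.2 ∧ p.1 < w.1
  · obtain ⟨p, hp, hp2, hp1⟩ := hleft
    refine ⟨_, .inr rfl, reach (by omega) fun i hi hiH => ?_⟩
    obtain rfl := hrow p hp _ hiH hp2 rfl
    rw [Set.mem_uIcc] at hi
    dsimp only at hp1
    omega
  · push Not at hleft
    refine ⟨_, .inl rfl, reach (by omega) fun i hi hiH => ?_⟩
    have hwi := hleft _ hiH rfl
    rw [Set.mem_uIcc] at hi
    obtain rfl : i = w.1 := by dsimp only at hwi; omega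
    exact hw.2 hiH

/-- If the first and last columns are joined, they reach each other and, through their rows, every
remaining border vertex, so that the outer part is connected. -/
theorem separatesColumns_of_not_connected (hcol : ∀ z ∈ H, z.1 ≠ x ∧ z.1 ≠ x + a - 1)
    (hrow : ∀ p ∈ H, ∀ q ∈ H, p.2 = q.2 → q.2 = y ∨ q.2 = y + b - 1 → p = q)
    (hconn : ¬ (lattice.induce (outer lattice (rect x y a b) H)).Connected) :
    SeparatesColumns x y a b H := by
  intro j j' hjj'
  have hj := mem_rect.1 hjj'.left_mem.1
  have hj' := mem_rect.1 hjj'.right_mem.1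
  dsimp only at hj hj'
  have column {s t t' : ℤ} (hs : s = x ∨ s = x + a - 1) (ht : y ≤ t ∧ t < y + b)
      (ht' : y ≤ t' ∧ t' < y + b) :
      ReachableIn lattice (rect x y a b \ H) (s, t) (s, t') := by
    refine reachableIn_column fun i hi => ⟨?_, fun hiH => ?_⟩
    · rw [Set.mem_uIcc] at hi
      simp only [mem_rect]
      omega
    · have := hcol _ hiH
      omega
  have side {s t : ℤ} (hs : s = x ∨ s = x + a - 1) (ht : y ≤ t ∧ t < y + b) :
      ReachableIn lattice (rect x y a b \ H) (s, t) (x, j) := by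
    rcases hs with rfl | rfl
    · exact column (.inl rfl) ht hj.2
    · exact (column (.inr rfl) ht hj'.2).trans hjj'.symm
  refine hconn (connected_outer (mem_outer_of_mem_side hjj'.left_mem (.inl rfl)) ?_)
  intro w hw n hn hnR
  have hwR := mem_rect.1 hw.1
  rcases or_assoc.2 (mem_side_of_adj hw.1 hn hnR) with hw1 | hw2
  · exact side hw1 hwR.2
  · obtain ⟨s, hs, hws⟩ := exists_reachableIn_end_of_row hw fun p hp q hq hp2 hq2 =>
      hrow p hp q hq (hp2.trans hq2.symm) (hq2 ▸ hw2)
    exact hws.trans (side hs hwR.2)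

/-- The border without one corner is a path through the opposite corner. -/
theorem connected_outer_of_mem_side_eq_corner (ha : 2 ≤ a) (hb : 2 ≤ b) (hp : p ∈ H)
    (hp1 : p.1 = x ∨ p.1 = x + a - 1) (hp2 : p.2 = y ∨ p.2 = y + b - 1)
    (hH : ∀ z ∈ H, z.1 = x ∨ z.1 = x + a - 1 ∨ z.2 = y ∨ z.2 = y + b - 1 → z = p) :
    (lattice.induce (outer lattice (rect x y a b) H)).Connected := by
  obtain ⟨c, d, hc, hd⟩ : ∃ c d, c = 2 * x + a - 1 - p.1 ∧ d = 2 * y + b - 1 - p.2 :=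
    ⟨_, _, rfl, rfl⟩
  have free {i j : ℤ} (hij : (i, j) ∈ rect x y a b)
      (hside : i = x ∨ i = x + a - 1 ∨ j = y ∨ j = y + b - 1) (hne : i ≠ p.1 ∨ j ≠ p.2) :
      (i, j) ∈ rect x y a b \ H := by
    refine ⟨hij, fun h => ?_⟩
    obtain rfl := hH _ h hside
    simp at hne
  have hcd : (c, d) ∈ rect x y a b \ H :=
    free (by simp only [mem_rect]; omega) (by omega) (by omega)
  refine connected_outer (mem_outer_of_mem_side hcd (by dsimp only; omega)) ?_
  rintro ⟨i, j⟩ hw n hn hnR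
  have hwR := mem_rect.1 hw.1
  have hside := mem_side_of_adj hw.1 hn hnR
  have hne : i ≠ p.1 ∨ j ≠ p.2 := by
    rw [← not_and_or]
    rintro ⟨rfl, rfl⟩
    exact hw.2 hp
  dsimp only at hwR hside
  rcases or_assoc.2 hside with hi | hj
  · refine (reachableIn_column (t := d) fun t ht => ?_).trans (reachableIn_row fun s hs => ?_)
    all_goals
      rw [Set.mem_uIcc] at *
      exact free (by simp only [mem_rect]; omega) (by omega) (by omega)
  · refine (reachableIn_row (t := c) fun s hs => ?_).trans (reachableIn_column fun t ht => ?_)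
    all_goals
      rw [Set.mem_uIcc] at *
      exact free (by simp only [mem_rect]; omega) (by omega) (by omega)

end ConnectedOuter

section SideBounds

variable {x y : ℤ} {a b m k : ℕ} {H : Set (ℤ × ℤ)} {z z' : ℤ × ℤ}

theorem OuterRanking.le_of_mem_first_column (h : OuterRanking lattice (rect x y a b) H k)
    (hD : ∀ a' < a, ∀ x', LabelBound lattice (rect x' y a' b) (min a' (2 * b)))
    (hz : z ∈ H) (hzx : z.1 = x) : min a (2 * b) ≤ H.ncard + k := by
  have hzR := mem_rect.1 (h.subset hz)
  have hsub : rect (x + a - (a - 1 : ℕ)) y (a - 1) b ⊆ rect x y a b :=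
    rect_subset_rect (by omega) (by omega) le_rfl le_rfl
  have hrest := h.le_ncard_inter_columns hD (a - 1) (by omega)
  have hdrop := ncard_inter_add_one_le h.finite hsub hz (h.subset hz)
    (by simp only [mem_rect]; omega)
  rw [Set.inter_eq_left.2 h.subset] at hdrop
  omega

theorem OuterRanking.le_of_mem_vertical_side (h : OuterRanking lattice (rect x y a b) H k)
    (hD : ∀ a' < a, ∀ x', LabelBound lattice (rect x' y a' b) (min a' (2 * b)))
    (hz : z ∈ H) (hzx : z.1 = x ∨ z.1 = x + a - 1) : min a (2 * b) ≤ H.ncard + k := by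
  rcases hzx with hzx | hzx
  · exact h.le_of_mem_first_column hD hz hzx
  · rw [← ncard_preimage_iso (GridRank.reflectFst (2 * x + a - 1))]
    refine h.reflectFst.le_of_mem_first_column (z := GridRank.reflectFst (2 * x + a - 1) z) hD
      (by simpa using hz) ?_
    simp only [reflectFst_apply]
    omega

theorem OuterRanking.le_of_two_mem_first_row (h : OuterRanking lattice (rect x y a b) H k)
    (hD : ∀ b' < b, ∀ y', LabelBound lattice (rect x y' a b') (min a (2 * b')))
    (hne : z ≠ z') (hz : z ∈ H) (hz' : z' ∈ H) (hzy : z.2 = y) (hzy' : z'.2 = y) :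
    min a (2 * b) ≤ H.ncard + k := by
  have hzR := mem_rect.1 (h.subset hz)
  have hsub : rect x (y + b - (b - 1 : ℕ)) a (b - 1) ⊆ rect x y a b :=
    rect_subset_rect le_rfl le_rfl (by omega) (by omega)
  have hrest := h.le_ncard_inter_rows hD (b - 1) (by omega)
  have hdrop := ncard_inter_add_two_le h.finite hsub hne hz (h.subset hz)
    (by simp only [mem_rect]; omega) hz' (h.subset hz') (by simp only [mem_rect]; omega)
  rw [Set.inter_eq_left.2 h.subset] at hdrop
  omega

theorem OuterRanking.le_of_two_mem_horizontal_side (h : OuterRanking lattice (rect x y a b) H k)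
    (hD : ∀ b' < b, ∀ y', LabelBound lattice (rect x y' a b') (min a (2 * b')))
    (hne : z ≠ z') (hz : z ∈ H) (hz' : z' ∈ H) (hzz' : z.2 = z'.2)
    (hzy : z'.2 = y ∨ z'.2 = y + b - 1) : min a (2 * b) ≤ H.ncard + k := by
  rcases hzy with hzy | hzy
  · exact h.le_of_two_mem_first_row hD hne hz hz' (hzz'.trans hzy) hzy
  · let σ := GridRank.reflectSnd (2 * y + b - 1)
    rw [← ncard_preimage_iso σ]
    refine h.reflectSnd.le_of_two_mem_first_row (z := σ z) (z' := σ z') hD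
      (σ.injective.ne hne) (by simpa [σ] using hz) (by simpa [σ] using hz') ?_ ?_ <;>
    simp only [σ, reflectSnd_apply] <;> omega

theorem OuterRanking.le_of_two_mem_lower_left_sides (h : OuterRanking lattice (rect x y m m) H k)
    (hD : ∀ m' < m, ∀ x' y', LabelBound lattice (rect x' y' m' m') ((5 * m' - 2) / 3))
    (hne : z ≠ z') (hz : z ∈ H) (hz' : z' ∈ H) (hzs : z.1 = x ∨ z.2 = y)
    (hzs' : z'.1 = x ∨ z'.2 = y) : (5 * m - 2) / 3 ≤ H.ncard + k := by
  have hzR := mem_rect.1 (h.subset hz)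
  have hsub : rect (x + m - (m - 1 : ℕ)) (y + m - (m - 1 : ℕ)) (m - 1) (m - 1) ⊆ rect x y m m :=
    rect_subset_rect (by omega) (by omega) (by omega) (by omega)
  have hrest := h.le_ncard_inter_corner hD (m - 1) (by omega)
  have hdrop := ncard_inter_add_two_le h.finite hsub hne hz (h.subset hz)
    (by simp only [mem_rect]; omega) hz' (h.subset hz') (by simp only [mem_rect]; omega)
  rw [Set.inter_eq_left.2 h.subset] at hdrop
  omega

theorem OuterRanking.le_of_two_mem_adjacent_sides (h : OuterRanking lattice (rect x y m m) H k)
    (hD : ∀ m' < m, ∀ x' y', LabelBound lattice (rect x' y' m' m') ((5 * m' - 2) / 3)) {c d : ℤ}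
    (hc : c = x ∨ c = x + m - 1) (hd : d = y ∨ d = y + m - 1) (hne : z ≠ z') (hz : z ∈ H)
    (hz' : z' ∈ H) (hzs : z.1 = c ∨ z.2 = d) (hzs' : z'.1 = c ∨ z'.2 = d) :
    (5 * m - 2) / 3 ≤ H.ncard + k := by
  wlog hcx : c = x generalizing c H z z'
  · let σ := GridRank.reflectFst (2 * x + m - 1)
    rw [← ncard_preimage_iso σ]
    refine this (z := σ z) (z' := σ z') h.reflectFst (.inl rfl) (σ.injective.ne hne)
      (by simpa [σ] using hz) (by simpa [σ] using hz') ?_ ?_ rfl <;>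
    simp only [σ, reflectFst_apply] <;> omega
  wlog hdy : d = y generalizing d H z z'
  · let σ := GridRank.reflectSnd (2 * y + m - 1)
    rw [← ncard_preimage_iso σ]
    refine this (z := σ z) (z' := σ z') (.inl rfl) h.reflectSnd (σ.injective.ne hne)
      (by simpa [σ] using hz) (by simpa [σ] using hz') ?_ ?_ rfl <;>
    simp only [σ, reflectSnd_apply] <;> omega
  subst hcx hdy
  exact h.le_of_two_mem_lower_left_sides hD hne hz hz' hzs hzs'

end SideBounds

section KingPath

/-- The king's graph on `ℤ × ℤ`: the lattice with both diagonals of every unit square added. -/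
def king : SimpleGraph (ℤ × ℤ) where
  Adj p q := p ≠ q ∧ (p.1 ≤ q.1 + 1 ∧ q.1 ≤ p.1 + 1) ∧ p.2 ≤ q.2 + 1 ∧ q.2 ≤ p.2 + 1
  symm := ⟨fun _ _ h => ⟨h.1.symm, h.2.1.symm, h.2.2.symm⟩⟩
  loopless := ⟨fun _ h => h.1 rfl⟩

theorem king_adj_of_mem_rect {i j : ℤ} {p q : ℤ × ℤ} (hp : p ∈ rect i j 2 2)
    (hq : q ∈ rect i j 2 2) (hpq : p ≠ q) : king.Adj p q := by
  rw [mem_rect] at hp hq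
  exact ⟨hpq, by omega, by omega⟩

/-- The parity of the number of ways in which the step from `p` to `q` passes between `A` and
`K`. -/
noncomputable def crossing (A K : Set (ℤ × ℤ)) (p q : ℤ × ℤ) : ZMod 2 :=
  A.indicator 1 p * K.indicator 1 q + K.indicator 1 p * A.indicator 1 q

/-- The parity of the number of crossings between `A` and `K` along `n` steps to the right from
`(s, j)`. -/
noncomputable def rowCrossing (A K : Set (ℤ × ℤ)) (s : ℤ) (n : ℕ) (j : ℤ) : ZMod 2 :=
  ∑ i ∈ Finset.range n, crossing A K (s + i, j) (s + (i + 1 : ℕ), j)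

variable {A K H : Set (ℤ × ℤ)} {p q : ℤ × ℤ} {i j s x y : ℤ} {n a b : ℕ}

theorem crossing_eq_zero_of_notMem (hp : p ∉ K) (hq : q ∉ K) : crossing A K p q = 0 := by
  simp [crossing, hp, hq]

theorem crossing_eq_add (hAK : Disjoint A K) (h : p ∈ A → q ∈ A ∪ K) (h' : q ∈ A → p ∈ A ∪ K) :
    crossing A K p q = A.indicator 1 p + A.indicator 1 q := by
  have hp : p ∈ A → p ∉ K := fun h => Set.disjoint_left.1 hAK h
  have hq : q ∈ A → q ∉ K := fun h => Set.disjoint_left.1 hAK h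
  have htwo : (1 : ZMod 2) + 1 = 0 := by decide
  unfold crossing
  by_cases hpA : p ∈ A <;> by_cases hqA : q ∈ A <;> simp_all

/-- Either `K` misses the square, or it contains all corners in `H`; the crossings then are the
changes between `A` and its complement, and there is an even number of these around the square. -/
theorem crossing_square (hAK : Disjoint A K)
    (hAH : ∀ p ∈ A, ∀ q ∈ rect i j 2 2, lattice.Adj p q → q ∈ A ∪ H)
    (hKH : ∀ u ∈ K, ∀ v ∈ H, king.Adj u v → v ∈ K) :
    crossing A K (i, j) (i + 1, j) + crossing A K (i, j + 1) (i + 1, j + 1) =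
      crossing A K (i, j) (i, j + 1) + crossing A K (i + 1, j) (i + 1, j + 1) := by
  have corner {e f : ℤ} (he : e = i ∨ e = i + 1) (hf : f = j ∨ f = j + 1) :
      (e, f) ∈ rect i j 2 2 := by
    simp only [mem_rect]
    omega
  by_cases hK : ∃ u ∈ K, u ∈ rect i j 2 2
  · obtain ⟨u, huK, hu⟩ := hK
    have step {p q} (hp : p ∈ A) (hq : q ∈ rect i j 2 2) (hpq : lattice.Adj p q) : q ∈ A ∪ K := by
      refine (hAH p hp q hq hpq).imp_right fun hqH => ?_
      rcases eq_or_ne u q with rfl | huq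
      · exact huK
      · exact hKH u huK q hqH (king_adj_of_mem_rect hu hq huq)
    have edge {p q} (hp : p ∈ rect i j 2 2) (hq : q ∈ rect i j 2 2) (hpq : lattice.Adj p q) :
        crossing A K p q = A.indicator 1 p + A.indicator 1 q :=
      crossing_eq_add hAK (step · hq hpq) (step · hp hpq.symm)
    rw [edge (corner (by simp) (by simp)) (corner (by simp) (by simp)) (by simp [lattice_adj]),
      edge (corner (by simp) (by simp)) (corner (by simp) (by simp)) (by simp [lattice_adj]),
      edge (corner (by simp) (by simp)) (corner (by simp) (by simp)) (by simp [lattice_adj]),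
      edge (corner (by simp) (by simp)) (corner (by simp) (by simp)) (by simp [lattice_adj])]
    abel
  · have miss {e f : ℤ} (he : e = i ∨ e = i + 1) (hf : f = j ∨ f = j + 1) : (e, f) ∉ K :=
      fun h => hK ⟨_, h, corner he hf⟩
    simp [crossing_eq_zero_of_notMem, miss]

theorem rowCrossing_add_one (hAK : Disjoint A K)
    (hAH : ∀ p ∈ A, ∀ q ∈ rect s j (n + 1) 2, lattice.Adj p q → q ∈ A ∪ H)
    (hKH : ∀ u ∈ K, ∀ v ∈ H, king.Adj u v → v ∈ K) (hfirst : ∀ j, (s, j) ∈ A)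
    (hlast : ∀ j, (s + n, j) ∉ A) : rowCrossing A K s n (j + 1) = rowCrossing A K s n j := by
  let vertical : ℕ → ZMod 2 := fun i => crossing A K (s + i, j) (s + i, j + 1)
  have hsquare : ∀ i ∈ Finset.range n, crossing A K (s + i, j + 1) (s + (i + 1 : ℕ), j + 1) -
      crossing A K (s + i, j) (s + (i + 1 : ℕ), j) = vertical (i + 1) - vertical i := by
    intro i hi
    rw [Finset.mem_range] at hi
    have hsub : rect (s + i) j 2 2 ⊆ rect s j (n + 1) 2 :=
      rect_subset_rect (by omega) (by omega) le_rfl le_rfl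
    have := crossing_square hAK (fun p hp q hq => hAH p hp q (hsub hq)) hKH
    simp only [vertical, CharTwo.sub_eq_add, Nat.cast_add, Nat.cast_one, ← add_assoc]
    rw [add_comm, this, add_comm]
  have hK0 : ∀ j, (s, j) ∉ K := fun j => Set.disjoint_left.1 hAK (hfirst j)
  have h0 : vertical 0 = 0 := by simp [vertical, crossing_eq_zero_of_notMem, hK0]
  have hn : vertical n = 0 := by simp [vertical, crossing, hlast]
  rw [← sub_eq_zero, rowCrossing, rowCrossing, ← Finset.sum_sub_distrib,
    Finset.sum_congr rfl hsquare, Finset.sum_range_sub, h0, hn, sub_zero]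

theorem rowCrossing_eq_one (hAK : Disjoint A K)
    (hAK' : ∀ p ∈ A, ∀ q ∈ rect s j (n + 1) 1, lattice.Adj p q → q ∈ A ∪ K)
    (hfirst : (s, j) ∈ A) (hlast : (s + n, j) ∉ A) : rowCrossing A K s n j = 1 := by
  have hstep : ∀ i ∈ Finset.range n, crossing A K (s + i, j) (s + (i + 1 : ℕ), j) =
      A.indicator 1 (s + (i + 1 : ℕ), j) - A.indicator 1 (s + (i : ℕ), j) := by
    intro i hi
    rw [Finset.mem_range] at hi
    rw [CharTwo.sub_eq_add, add_comm (A.indicator _ _)]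
    refine crossing_eq_add hAK (fun hp => hAK' _ hp _ ?_ ?_) (fun hp => hAK' _ hp _ ?_ ?_) <;>
    simp only [mem_rect, lattice_adj, true_and] <;> omega
  rw [rowCrossing, Finset.sum_congr rfl hstep,
    Finset.sum_range_sub fun i : ℕ => A.indicator (1 : ℤ × ℤ → ZMod 2) (s + i, j)]
  simp [hfirst, hlast, CharTwo.neg_eq]

theorem exists_mem_last_row (hb : 1 ≤ b) (hAK : Disjoint A K)
    (hAH : ∀ p ∈ A, ∀ q ∈ rect s y (n + 1) b, lattice.Adj p q → q ∈ A ∪ H)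
    (hKH : ∀ u ∈ K, ∀ v ∈ H, king.Adj u v → v ∈ K) (hrow : ∀ z ∈ H, z.2 = y → z ∈ K)
    (hfirst : ∀ j, (s, j) ∈ A) (hlast : ∀ j, (s + n, j) ∉ A) : ∃ i, (i, y + b - 1) ∈ K := by
  obtain ⟨b, rfl⟩ := Nat.exists_eq_add_of_le' hb
  have hconst : ∀ c ≤ b, rowCrossing A K s n (y + c) = 1 := by
    intro c hc
    induction c with
    | zero =>
      have hsub : rect s y (n + 1) 1 ⊆ rect s y (n + 1) (b + 1) :=
        rect_subset_rect le_rfl le_rfl le_rfl (by omega)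
      rw [Nat.cast_zero, add_zero]
      refine rowCrossing_eq_one hAK (fun p hp q hq hpq => ?_) (hfirst y) (hlast y)
      refine (hAH p hp q (hsub hq) hpq).imp_right fun hqH => hrow q hqH ?_
      rw [mem_rect] at hq
      omega
    | succ c ih =>
      have hsub : rect s (y + c) (n + 1) 2 ⊆ rect s y (n + 1) (b + 1) :=
        rect_subset_rect le_rfl le_rfl (by omega) (by omega)
      rw [Nat.cast_succ, ← add_assoc, rowCrossing_add_one hAK
        (fun p hp q hq => hAH p hp q (hsub hq)) hKH hfirst hlast, ih (by omega)]
  rw [Nat.cast_succ, ← add_assoc, add_sub_cancel_right]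
  by_contra! hK
  have hzero : rowCrossing A K s n (y + b) = 0 :=
    Finset.sum_eq_zero fun i _ => crossing_eq_zero_of_notMem (hK _) (hK _)
  simp [hconst b le_rfl] at hzero

/-- Let `A` be the part of the rectangle reachable from the first column, together with the column
before it, and let `K` be the part of `H` reachable by king moves from the first row. The number of
crossings between them has the same parity in all rows, and it is odd in the first one. -/
theorem exists_king_path_of_separatesColumns (ha : 1 ≤ a) (hb : 1 ≤ b)
    (hH : H ⊆ rect x y a b) (hsep : SeparatesColumns x y a b H) :
    ∃ i i', ∃ p : king.Walk (i, y) (i', y + b - 1), p.IsPath ∧ ∀ z ∈ p.support, z ∈ H := by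
  classical
  let A : Set (ℤ × ℤ) := {z | z.1 = x - 1 ∨ ∃ j, ReachableIn lattice (rect x y a b \ H) (x, j) z}
  let K : Set (ℤ × ℤ) := {z | ∃ i, ReachableIn king H (i, y) z}
  suffices h : ∃ i', (i', y + b - 1) ∈ K by
    obtain ⟨i', i, p, hp⟩ := h
    exact ⟨i, i', p.bypass, p.bypass_isPath, fun z hz => hp z (p.support_bypass_subset_support hz)⟩
  have hAK : Disjoint A K := by
    refine Set.disjoint_left.2 fun z hzA ⟨i, hi⟩ => ?_
    rcases hzA with hzx | ⟨j, hj⟩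
    · have := mem_rect.1 (hH hi.right_mem)
      omega
    · exact hj.right_mem.2 hi.right_mem
  have hAH : ∀ p ∈ A, ∀ q ∈ rect (x - 1) y (a + 1) b, lattice.Adj p q → q ∈ A ∪ H := by
    intro p hp q hq hpq
    refine or_iff_not_imp_right.2 fun hqH => or_iff_not_imp_left.2 fun hqx => ?_
    rw [mem_rect] at hq
    have hqR : q ∈ rect x y a b \ H := ⟨by rw [mem_rect]; omega, hqH⟩
    rcases hp with hp | ⟨j, hj⟩
    · obtain rfl : x = q.1 := by
        rw [lattice_adj] at hpq
        omega
      exact ⟨q.2, .refl hqR⟩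
    · exact ⟨j, hj.trans (.of_adj hpq hj.right_mem hqR)⟩
  have hKH : ∀ u ∈ K, ∀ v ∈ H, king.Adj u v → v ∈ K := fun u ⟨i, hi⟩ v hv huv =>
    ⟨i, hi.trans (.of_adj huv hi.right_mem hv)⟩
  have hrow : ∀ z ∈ H, z.2 = y → z ∈ K := by
    rintro z hz rfl
    exact ⟨z.1, .refl hz⟩
  refine exists_mem_last_row (s := x - 1) (n := a) hb hAK hAH hKH hrow (fun j => .inl rfl)
    fun j hj => ?_
  rcases hj with hj | ⟨j', hj⟩
  · dsimp only at hj
    omega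
  · exact hsep j' j (by rwa [show x + a - 1 = x - 1 + a by ring])

end KingPath

section UnitSteps

/-- Each of the first `n` steps of `f` changes its value by at most one. -/
def UnitSteps (f : ℕ → ℤ) (n : ℕ) : Prop := ∀ i < n, |f (i + 1) - f i| ≤ 1

theorem UnitSteps.abs_sub_le {f : ℕ → ℤ} {n i j : ℕ} (hf : UnitSteps f n) (hij : i ≤ j)
    (hj : j ≤ n) : |f j - f i| ≤ j - i := by
  induction j, hij using Nat.le_induction with
  | base => simp
  | succ j _ ih =>
    have hstep := hf j (by omega)
    have hprefix := ih (by omega)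
    rw [abs_le] at *
    omega

variable {u v : ℤ × ℤ}

theorem unitSteps_fst_getVert (p : king.Walk u v) :
    UnitSteps (fun i => (p.getVert i).1) p.length := fun i hi => by
  have := (p.adj_getVert_succ hi).2.1
  simp only [abs_le]
  omega

theorem unitSteps_snd_getVert (p : king.Walk u v) :
    UnitSteps (fun i => (p.getVert i).2) p.length := fun i hi => by
  have := (p.adj_getVert_succ hi).2.2
  simp only [abs_le]
  omega

theorem ncard_support {V : Type*} {G : SimpleGraph V} {u v : V} {p : G.Walk u v}
    (hp : p.IsPath) : {z | z ∈ p.support}.ncard = p.length + 1 := by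
  classical
  rw [← List.coe_toFinset, Set.ncard_coe_finset, List.toFinset_card_of_nodup hp.support_nodup,
    p.length_support]

end UnitSteps

section RectBound

variable {x y y' i i' c : ℤ} {a b w P k : ℕ} {H X : Set (ℤ × ℤ)}

theorem OuterRanking.le_of_disjoint_left_window (h : OuterRanking lattice (rect x y a b) H k)
    (hD : ∀ w' ≤ w, ∀ P' ≤ P, ∀ y', LabelBound lattice (rect x y' w' P') (min P' (2 * w')))
    (hw : w ≤ a) (hy : y ≤ y') (hP : y' + P ≤ y + b) (hX : X ⊆ H)
    (hdisj : Disjoint X (rect x y' w P)) : min P (2 * w) + X.ncard ≤ H.ncard + k := by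
  have hwindow := h.le_ncard_inter_left_window hD hw hy hP
  have hrest := ncard_inter_add_ncard_le h.finite
    (rect_subset_rect le_rfl (by omega) hy hP : rect x y' w P ⊆ rect x y a b)
    fun z hz => ⟨hX hz, h.subset (hX hz), Set.disjoint_left.1 hdisj hz⟩
  rw [Set.inter_eq_left.2 h.subset] at hrest
  omega

theorem OuterRanking.le_of_disjoint_side_window (h : OuterRanking lattice (rect x y a b) H k)
    (hD : ∀ w' ≤ w, ∀ P' ≤ P, ∀ y', LabelBound lattice (rect x y' w' P') (min P' (2 * w')))
    (hw : w ≤ a) (hy : y ≤ y') (hP : y' + P ≤ y + b) (hX : X ⊆ H)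
    (hc : c = x ∨ c = x + a - w) (hdisj : Disjoint X (rect c y' w P)) :
    min P (2 * w) + X.ncard ≤ H.ncard + k := by
  rcases hc with rfl | rfl
  · exact h.le_of_disjoint_left_window hD hw hy hP hX hdisj
  · let σ := GridRank.reflectFst (2 * x + a - 1)
    rw [← ncard_preimage_iso (H := H) σ, ← ncard_preimage_iso (H := X) σ]
    refine h.reflectFst.le_of_disjoint_left_window hD hw hy hP (Set.preimage_mono hX)
      (Set.disjoint_left.2 fun z hz hzW => Set.disjoint_left.1 hdisj hz ?_)
    simp only [mem_rect, σ, reflectFst_apply] at hzW ⊢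
    omega

theorem OuterRanking.min_le_of_king_path (h : OuterRanking lattice (rect x y a b) H k)
    (hD : ∀ w' < a, ∀ P' ≤ b, ∀ y', LabelBound lattice (rect x y' w' P') (min P' (2 * w')))
    {p : king.Walk (i, y) (i', y + b - 1)} (hp : p.IsPath) (hpH : ∀ z ∈ p.support, z ∈ H) :
    min a (2 * b) ≤ H.ncard + k := by
  have hX := ncard_support hp
  have hXH : {z | z ∈ p.support}.ncard ≤ H.ncard := Set.ncard_le_ncard hpH h.finite
  have hbl := (unitSteps_snd_getVert p).abs_sub_le (Nat.zero_le _) le_rfl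
  simp only [Walk.getVert_zero, Walk.getVert_length, abs_le] at hbl
  obtain hal | hal := le_or_gt a (p.length + 1)
  · omega
  obtain ⟨w, hw⟩ : ∃ w, w = (a - p.length) / 2 := ⟨_, rfl⟩
  by_contra hcon
  have visits {c : ℤ} (hc : c = x ∨ c = x + a - w) :
      ∃ t ≤ p.length, p.getVert t ∈ rect c y w b := by
    by_contra! hno
    refine hcon ?_
    have := h.le_of_disjoint_side_window (X := {z | z ∈ p.support})
      (fun w' hw' => hD w' (by omega)) (by omega) le_rfl le_rfl hpH hc
      (Set.disjoint_left.2 fun z hz => ?_)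
    · omega
    · obtain ⟨t, rfl, ht⟩ := Walk.mem_support_iff_exists_getVert.1 hz
      exact hno t ht
  obtain ⟨s, hs, hsW⟩ := visits (.inl rfl)
  obtain ⟨t, ht, htW⟩ := visits (.inr rfl)
  have hfst := unitSteps_fst_getVert p
  rw [mem_rect] at hsW htW
  rcases le_total s t with hst | hts
  · have := (abs_le.1 (hfst.abs_sub_le hst ht)).2
    omega
  · have := (abs_le.1 (hfst.abs_sub_le hts hs)).1
    omega

/-- The induction is on `a + b` because the windows at the vertical sides are used with the bound
for their transposes. -/
theorem labelBound_rect (x y : ℤ) (a b : ℕ) :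
    LabelBound lattice (rect x y a b) (min a (2 * b)) := by
  induction hn : a + b using Nat.strong_induction_on generalizing x y a b with
  | _ n ih =>
  subst hn
  rcases Nat.eq_zero_or_pos a with rfl | ha
  · simp [LabelBound]
  rcases Nat.eq_zero_or_pos b with rfl | hb
  · simp [LabelBound]
  refine labelBound_of_not_connected fun H k h hconn => ?_
  by_contra hcon
  have hcol : ∀ z ∈ H, z.1 ≠ x ∧ z.1 ≠ x + a - 1 := fun z hz => not_or.1 fun hzx =>
    hcon (h.le_of_mem_vertical_side (fun a' ha' x' => ih (a' + b) (by omega) x' y a' b rfl) hz hzx)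
  have hrow : ∀ p ∈ H, ∀ q ∈ H, p.2 = q.2 → q.2 = y ∨ q.2 = y + b - 1 → p = q :=
    fun p hp q hq hpq hside => by_contra fun hne => hcon (h.le_of_two_mem_horizontal_side
      (fun b' hb' y' => ih (a + b') (by omega) x y' a b' rfl) hne hp hq hpq hside)
  obtain ⟨i, i', p, hp, hpH⟩ := exists_king_path_of_separatesColumns ha hb h.subset
    (separatesColumns_of_not_connected hcol hrow hconn)
  exact hcon (h.min_le_of_king_path (fun w hw P hP y' =>
    (ih (P + w) (by omega) y' x P w rfl).transpose) hp hpH)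

end RectBound

section Visits

/-- Within the times in `T`, `f` visits every window of length `ℓ` in `[0, m)`. -/
def VisitsWindows (f : ℕ → ℤ) (T : Set ℕ) (m ℓ : ℤ) : Prop :=
  ∀ j, 0 ≤ j → j + ℓ ≤ m → ∃ i ∈ T, j ≤ f i ∧ f i < j + ℓ

variable {f : ℕ → ℤ} {n s t u : ℕ} {m ℓ : ℤ} {T B : Set ℕ}

/-- Before `t` the times in `T` reach some height, and after it they come from some height; a
window between the two would be missed. -/
theorem UnitSteps.le_of_mem_between (hf : UnitSteps f n) (h0 : f 0 = 0) (hn : f n = m - 1)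
    (hT : ∀ i ∈ T, i ≤ n ∧ 0 ≤ f i ∧ f i < m) (hvisit : VisitsWindows f T m ℓ) (hℓ : ℓ ≤ m)
    (hsep : ∀ i ∈ T, m - ℓ + 1 ≤ |(i : ℤ) - t|) (hs : s ∈ T) (hst : s < t) (hu : u ∈ T)
    (htu : t < u) : 3 * (m - ℓ) + 1 ≤ n := by
  have hfin : T.Finite := (Set.finite_Iic n).subset fun i hi => (hT i hi).1
  obtain ⟨i, ⟨hi, hit⟩, himax⟩ := (T ∩ Set.Iio t).exists_max_image f
    (hfin.inter_of_left _) ⟨s, hs, hst⟩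
  obtain ⟨j, ⟨hj, htj⟩, hjmin⟩ := (T ∩ Set.Ioi t).exists_min_image f
    (hfin.inter_of_left _) ⟨u, hu, htu⟩
  have hji : f j ≤ f i + ℓ := by
    by_contra hgap
    obtain ⟨l, hl, hil, hlj⟩ := hvisit (f i + 1) (by have := hT i hi; omega)
      (by have := hT j hj; omega)
    rcases lt_trichotomy l t with hlt | rfl | hlt
    · have := himax l ⟨hl, hlt⟩
      omega
    · have := hsep l hl
      rw [sub_self, abs_zero] at this
      omega
    · have := hjmin l ⟨hl, hlt⟩
      omega
  rw [Set.mem_Iio] at hit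
  rw [Set.mem_Ioi] at htj
  have hi_sep := hsep i hi
  have hj_sep := hsep j hj
  rw [abs_of_neg (by omega)] at hi_sep
  rw [abs_of_pos (by omega)] at hj_sep
  have hstart := abs_le.1 (hf.abs_sub_le (Nat.zero_le i) (hT i hi).1)
  have hend := abs_le.1 (hf.abs_sub_le (hT j hj).1 le_rfl)
  omega

theorem UnitSteps.le_of_high_before_low (hf : UnitSteps f n) (h0 : f 0 = 0) (hn : f n = m - 1)
    (hsep : m - ℓ + 1 ≤ |(s : ℤ) - t|) (hst : s < t) (ht : t ≤ n) (hfs : m - ℓ ≤ f s)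
    (hft : f t < ℓ) : 3 * (m - ℓ) + 1 ≤ n := by
  rw [abs_of_neg (by omega)] at hsep
  have hstart := abs_le.1 (hf.abs_sub_le (Nat.zero_le s) (by omega))
  have hend := abs_le.1 (hf.abs_sub_le ht le_rfl)
  omega

theorem UnitSteps.le_of_visitsWindows (hf : UnitSteps f n) (h0 : f 0 = 0) (hn : f n = m - 1)
    (hT : ∀ i ∈ T, i ≤ n ∧ 0 ≤ f i ∧ f i < m) (hB : ∀ i ∈ B, i ≤ n ∧ 0 ≤ f i ∧ f i < m)
    (hvT : VisitsWindows f T m ℓ) (hvB : VisitsWindows f B m ℓ) (hℓ : ℓ ≤ m)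
    (hsep : ∀ i ∈ T, ∀ j ∈ B, m - ℓ + 1 ≤ |(i : ℤ) - j|) : 3 * (m - ℓ) + 1 ≤ n := by
  have hsep' : ∀ i ∈ B, ∀ j ∈ T, m - ℓ + 1 ≤ |(i : ℤ) - j| := fun i hi j hj =>
    abs_sub_comm (j : ℤ) i ▸ hsep j hj i hi
  have hne : ∀ i ∈ T, ∀ j ∈ B, i ≠ j := by
    rintro i hi _ hj rfl
    have := hsep i hi i hj
    rw [sub_self, abs_zero] at this
    omega
  obtain ⟨s, hs, -, hslow⟩ := hvT 0 le_rfl (by omega)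
  obtain ⟨s', hs', hshigh, -⟩ := hvT (m - ℓ) (by omega) (by omega)
  obtain ⟨t, ht, -, htlow⟩ := hvB 0 le_rfl (by omega)
  obtain ⟨t', ht', hthigh, -⟩ := hvB (m - ℓ) (by omega) (by omega)
  rcases (hne s' hs' t ht).lt_or_gt with hst | hts'
  · exact hf.le_of_high_before_low h0 hn (hsep s' hs' t ht) hst (hB t ht).1 hshigh (by omega)
  rcases (hne s hs t' ht').lt_or_gt with hst' | hts
  · rcases (hne s hs t ht).lt_or_gt with hst | hts
    · exact hf.le_of_mem_between h0 hn hT hvT hℓ (fun i hi => hsep i hi t ht) hs hst hs' hts'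
    · exact hf.le_of_mem_between h0 hn hB hvB hℓ (fun i hi => hsep' i hi s hs) ht hts ht' hst'
  · exact hf.le_of_high_before_low h0 hn (hsep' t' ht' s hs) hts (hT s hs).1 hthigh (by omega)

end Visits

section SquareBound

variable {x y i i' c : ℤ} {m k q : ℕ} {H : Set (ℤ × ℤ)}

theorem OuterRanking.visitsWindows (h : OuterRanking lattice (rect x y m m) H k)
    {u v : ℤ × ℤ} {p : king.Walk u v} (hp : p.IsPath) (hpH : ∀ z ∈ p.support, z ∈ H) (hq : q ≤ m)
    (hc : c = x ∨ c = x + m - q) (hlt : H.ncard + k ≤ 2 * q + p.length) :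
    VisitsWindows (fun t => (p.getVert t).2 - y)
      {t | t ≤ p.length ∧ c ≤ (p.getVert t).1 ∧ (p.getVert t).1 < c + q} m (2 * q) := by
  intro j hj hjm
  by_contra! hno
  have hX := ncard_support hp
  have := h.le_of_disjoint_side_window (X := {z | z ∈ p.support}) (w := q) (P := 2 * q)
    (y' := y + j) (fun w' _ P' _ y' => (labelBound_rect y' x P' w').transpose) hq
    (by omega) (by push_cast; omega) hpH hc (Set.disjoint_left.2 fun z hz hzW => ?_)
  · omega
  · obtain ⟨t, rfl, ht⟩ := Walk.mem_support_iff_exists_getVert.1 hz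
    rw [mem_rect] at hzW
    have := hno t ⟨ht, hzW.1⟩
    omega

/-- With `q = (3 * m - p.length) / 6`, a window of `q` columns and `2 * q` rows at a vertical side
that the path misses forces `2 * q` further deletions or labels; a path meeting all of these windows
has more than `3 * m - 6 * q` steps. -/
theorem OuterRanking.le_of_king_path (h : OuterRanking lattice (rect x y m m) H k)
    {p : king.Walk (i, y) (i', y + m - 1)} (hp : p.IsPath) (hpH : ∀ z ∈ p.support, z ∈ H) :
    (5 * m - 2) / 3 ≤ H.ncard + k := by
  have hX := ncard_support hp
  have hXH : {z | z ∈ p.support}.ncard ≤ H.ncard := Set.ncard_le_ncard hpH h.finite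
  have hfst := unitSteps_fst_getVert p
  have hmp := (unitSteps_snd_getVert p).abs_sub_le (Nat.zero_le _) le_rfl
  simp only [Walk.getVert_zero, Walk.getVert_length, abs_le] at hmp
  have hR : ∀ t, p.getVert t ∈ rect x y m m := fun t => h.subset (hpH _ (p.getVert_mem_support t))
  simp only [mem_rect] at hR
  obtain ⟨q, hq⟩ : ∃ q, q = (3 * m - p.length) / 6 := ⟨_, rfl⟩
  by_contra hcon
  have visits {c : ℤ} (hc : c = x ∨ c = x + m - q) :=
    h.visitsWindows hp hpH (by omega) hc (by omega)
  have far_apart {s t : ℕ} (hs : s ≤ p.length) (ht : t ≤ p.length) (hsx : (p.getVert s).1 < x + q)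
      (htx : x + m - q ≤ (p.getVert t).1) : (m : ℤ) - 2 * q + 1 ≤ |(s : ℤ) - t| := by
    rcases le_total s t with hst | hts
    · have := (abs_le.1 (hfst.abs_sub_le hst ht)).2
      rw [abs_of_nonpos (by omega)]
      omega
    · have := (abs_le.1 (hfst.abs_sub_le hts hs)).1
      rw [abs_of_nonneg (by omega)]
      omega
  have hlength := UnitSteps.le_of_visitsWindows (f := fun t => (p.getVert t).2 - y) (n := p.length)
    (fun t ht => by simpa using unitSteps_snd_getVert p t ht) (by simp)
    (by simp only [Walk.getVert_length]; ring)
    (fun t ht => ⟨ht.1, by have := hR t; omega⟩) (fun t ht => ⟨ht.1, by have := hR t; omega⟩)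
    (visits (.inl rfl)) (visits (.inr rfl)) (by omega)
    fun s hs t ht => far_apart hs.1 ht.1 hs.2.2 ht.2.1
  omega

theorem OuterRanking.le_of_free_vertical_sides (h : OuterRanking lattice (rect x y m m) H k)
    (hm : 1 ≤ m) (hcol : ∀ z ∈ H, z.1 ≠ x ∧ z.1 ≠ x + m - 1)
    (hrow : ∀ p ∈ H, ∀ q ∈ H, p.2 = q.2 → q.2 = y ∨ q.2 = y + m - 1 → p = q)
    (hconn : ¬ (lattice.induce (outer lattice (rect x y m m) H)).Connected) :
    (5 * m - 2) / 3 ≤ H.ncard + k := by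
  obtain ⟨i, i', p, hp, hpH⟩ := exists_king_path_of_separatesColumns hm hm h.subset
    (separatesColumns_of_not_connected hcol hrow hconn)
  exact h.le_of_king_path hp hpH

theorem OuterRanking.le_of_free_horizontal_sides (h : OuterRanking lattice (rect x y m m) H k)
    (hm : 1 ≤ m) (hrow : ∀ z ∈ H, z.2 ≠ y ∧ z.2 ≠ y + m - 1)
    (hcol : ∀ p ∈ H, ∀ q ∈ H, p.1 = q.1 → q.1 = x ∨ q.1 = x + m - 1 → p = q)
    (hconn : ¬ (lattice.induce (outer lattice (rect x y m m) H)).Connected) :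
    (5 * m - 2) / 3 ≤ H.ncard + k := by
  rw [← ncard_preimage_iso GridRank.transpose]
  refine h.transpose.le_of_free_vertical_sides hm (fun z hz => hrow _ hz)
    (fun p hp q hq hpq hside =>
      GridRank.transpose.injective (hcol _ hp _ hq hpq hside)) fun hconn' => hconn ?_
  rw [← preimage_transpose_rect] at hconn'
  exact connected_outer_of_preimage _ hconn'

/-- At most one deleted vertex lies on any two adjacent sides. If some vertical and some horizontal
side are met, this makes a corner the only deleted vertex on the border, which is then connected. -/
theorem labelBound_square (x y : ℤ) (m : ℕ) :
    LabelBound lattice (rect x y m m) ((5 * m - 2) / 3) := by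
  induction m using Nat.strong_induction_on generalizing x y with
  | _ m ih =>
  rcases Nat.eq_zero_or_pos m with rfl | hm
  · simp [LabelBound]
  refine labelBound_of_not_connected fun H k h hconn => ?_
  by_contra hcon
  have unique {c d : ℤ} (hc : c = x ∨ c = x + m - 1) (hd : d = y ∨ d = y + m - 1) :
      ∀ z ∈ H, ∀ z' ∈ H, z.1 = c ∨ z.2 = d → z'.1 = c ∨ z'.2 = d → z = z' :=
    fun z hz z' hz' hzs hzs' => by_contra fun hne =>
      hcon (h.le_of_two_mem_adjacent_sides (fun m' hm' x' y' => ih m' hm' x' y') hc hd hne hz hz'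
        hzs hzs')
  obtain ⟨p, hp, hpx⟩ : ∃ p ∈ H, p.1 = x ∨ p.1 = x + m - 1 := by
    by_contra! hfree
    exact hcon (h.le_of_free_vertical_sides hm hfree
      (fun p hp q hq hpq hq2 => unique (.inl rfl) hq2 p hp q hq (.inr hpq) (.inr rfl)) hconn)
  obtain ⟨q, hq, hqy⟩ : ∃ q ∈ H, q.2 = y ∨ q.2 = y + m - 1 := by
    by_contra! hfree
    exact hcon (h.le_of_free_horizontal_sides hm hfree
      (fun p hp q hq hpq hq1 => unique hq1 (.inl rfl) p hp q hq (.inl hpq) (.inl rfl)) hconn)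
  obtain rfl : p = q := unique hpx hqy p hp q hq (.inl rfl) (.inr rfl)
  have hcard := (Set.ncard_pos h.finite).2 ⟨p, hp⟩
  refine hconn (connected_outer_of_mem_side_eq_corner (by omega) (by omega) hp hpx hqy ?_)
  rintro z hz (hzx | hzx | hzy | hzy)
  · exact unique (.inl rfl) hqy z hz p hp (.inl hzx) (.inr rfl)
  · exact unique (.inr rfl) hqy z hz p hp (.inl hzx) (.inr rfl)
  · exact unique hpx (.inl rfl) z hz p hp (.inr hzy) (.inl rfl)
  · exact unique hpx (.inr rfl) z hz p hp (.inr hzy) (.inl rfl)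

end SquareBound

section Grid

variable {m n k : ℕ}

/-- The lattice rectangle `[0, m) × [0, n)` mapped into the `m × n` grid graph. -/
def rectToGrid (m n : ℕ) : lattice.induce (rect 0 0 m n) →g gridGraph m n where
  toFun z := (⟨z.1.1.toNat, by have := mem_rect.1 z.2; omega⟩,
    ⟨z.1.2.toNat, by have := mem_rect.1 z.2; omega⟩)
  map_rel' {z w} h := by
    have hz := mem_rect.1 z.2
    have hw := mem_rect.1 w.2
    rw [comap_adj, lattice_adj] at h
    simp only [Function.Embedding.subtype_apply] at h
    simp only [gridGraph, boxProd_adj, pathGraph_adj, Fin.ext_iff]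
    omega

theorem rectToGrid_injective : Function.Injective (rectToGrid m n) := by
  rintro ⟨z, hz⟩ ⟨w, hw⟩ h
  rw [mem_rect] at hz hw
  simp only [rectToGrid, RelHom.coeFn_mk, Prod.mk.injEq, Fin.mk.injEq] at h
  exact Subtype.ext (Prod.ext (by dsimp only; omega) (by dsimp only; omega))

theorem Rankable.outerRanking (h : Rankable (gridGraph m n) k) :
    OuterRanking lattice (rect 0 0 m n) ∅ k where
  subset := Set.empty_subset _
  finite := Set.finite_empty
  rankable := (h.of_injective_hom (rectToGrid m n) rectToGrid_injective).mono
    (outer_subset.trans Set.sdiff_subset)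

theorem five_mul_le_rankNumber_gridGraph (m : ℕ) : 5 * m ≤ 3 * rankNumber (gridGraph m m) + 4 := by
  have hrank : Rankable (gridGraph m m) (rankNumber (gridGraph m m)) := (isLeast_rankNumber _).1
  have hbound := labelBound_square 0 0 m _ _ hrank.outerRanking
  rw [Set.ncard_empty] at hbound
  omega

end Grid

end GridRank

theorem mainTheorem3_general (m : ℕ) :
    (5 / 3 : ℝ) * m - 4 / 3 ≤ rankNumber (gridGraph m m) := by
  have h : (5 : ℝ) * m ≤ 3 * rankNumber (gridGraph m m) + 4 := by
    exact_mod_cast GridRank.five_mul_le_rankNumber_gridGraph m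
  linarith

theorem mainTheorem3 (m : ℕ) (hm : 1 ≤ m) :
    (5 / 3 : ℝ) * (m : ℝ) - 25 / 9 ≤ (rankNumber (gridGraph m m) : ℝ) := by
  linarith [mainTheorem3_general m]
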